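/- Let $G=(V,E)$ be a finite undirected unweighted multigraph with at least two vertices, let $m=|E|$ (parallel edges counted separately), and let $\lambda$ be the minimum, over all $\emptyset\subsetneq S\subsetneq V$, of the weight of the cut $(S,V\setminus S)$, i.e. of the number of edges between $S$ and $V\setminus S$. A tree packing $\mathcal T$ is a nonempty finite multiset of spanning trees of $G$ (so $G$ is connected). The load $\mathcal L^{\mathcal T}(e)$ of an edge $e$ is the number of trees of $\mathcal T$, counted with multiplicity, that contain $e$; its relative load is $\ell^{\mathcal T}(e)=\mathcal L^{\mathcal T}(e)/|\mathcal T|$; and $\mathrm{pack\_val}(\mathcal T)=1/\max_{e\in E}\ell^{\mathcal T}(e)$. The packing $\mathcal T$ is greedy if its trees can be listed as $T_1,\dots,T_k$ so that each $T_i$ is a minimum spanning tree of $G$ with respect to the edge costs given by the loads of $\{T_1,\dots,T_{i-1}\}$. Let $\epsilon>0$ and let $\mathcal T$ be a greedy tree packing of $G$ with $|\mathcal T|\ge 6\lambda\ln m/\epsilon^2$. Then: 1. If $\epsilon<2$, then $\lambda\le(2+\epsilon)\cdot\mathrm{pack\_val}(\mathcal T)$. 2. If some minimum cut (a cut of weight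 $\lambda$) is crossed by at least two edges of every tree in $\mathcal T$, then $(2+\epsilon)\cdot\mathrm{pack\_val}(\mathcal T)\le(1+\epsilon/2)\lambda$. -/

import Mathlib

namespace TreePacking

variable {α β : Type*}

/-- The vertices `x` and `y` are joined by a walk of `G` that uses only edges in `F`. -/
def Joined (G : Graph α β) (F : Set β) (x y : α) : Prop :=
  Relation.ReflTransGen (G.restrict F).Adj x y

/-- `T` is the edge set of a spanning tree of the multigraph `G`: the subgraph `(V(G), T)` is
connected, and it contains no cycle, i.e. no edge of `T` has its two ends joined by the
other edges of `T`. -/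
structure IsSpanningTree (G : Graph α β) (T : Finset β) : Prop where
  subset : (T : Set β) ⊆ G.edgeSet
  connected : ∀ x ∈ G.vertexSet, ∀ y ∈ G.vertexSet, Joined G (T : Set β) x y
  acyclic : ∀ e ∈ T, ∀ x y, G.IsLink e x y → ¬ Joined G ((T : Set β) \ {e}) x y

/-- `T` is a spanning tree of minimum total cost for the edge costs `c`. -/
def IsMinSpanningTree (G : Graph α β) (c : β → ℕ) (T : Finset β) : Prop :=
  IsSpanningTree G T ∧ ∀ T', IsSpanningTree G T' → ∑ e ∈ T, c e ≤ ∑ e ∈ T', c e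

/-- A tree packing is a multiset of spanning trees. -/
def IsTreePacking (G : Graph α β) (P : Multiset (Finset β)) : Prop :=
  ∀ T ∈ P, IsSpanningTree G T

open Classical in
/-- The load of `e`: the number of trees of `P` (with multiplicity) that contain `e`. -/
noncomputable def load (P : Multiset (Finset β)) (e : β) : ℕ :=
  P.countP (fun T => e ∈ T)

/-- The relative load of `e`. -/
noncomputable def relLoad (P : Multiset (Finset β)) (e : β) : ℝ :=
  (load P e : ℝ) / (Multiset.card P : ℝ)

/-- `P` is a greedy tree packing: its trees can be listed as `T₁, …, T_k` such that every `T_i` is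
a minimum spanning tree with respect to the loads induced by `T₁, …, T_{i-1}`. -/
def IsGreedyTreePacking (G : Graph α β) (P : Multiset (Finset β)) : Prop :=
  IsTreePacking G P ∧ ∃ L : List (Finset β), (L : Multiset (Finset β)) = P ∧
    ∀ (i : ℕ) (hi : i < L.length),
      IsMinSpanningTree G (load (L.take i : Multiset (Finset β))) L[i]

/-- The packing value `1 / max_{e ∈ E} ℓ(e)`. The supremum is a maximum when the edge set of `G` is
finite and nonempty. -/
noncomputable def packVal (G : Graph α β) (P : Multiset (Finset β)) : ℝ :=
  1 / ⨆ e : G.edgeSet, relLoad P (e : β)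

/-- `S` is one side of a cut `(S, V \ S)`. -/
def IsCut (G : Graph α β) (S : Set α) : Prop :=
  S.Nonempty ∧ S ⊂ G.vertexSet

/-- The edges crossing between `S` and `V \ S`. -/
def cutEdges (G : Graph α β) (S : Set α) : Set β :=
  {e | ∃ x ∈ S, ∃ y ∈ G.vertexSet \ S, G.IsLink e x y}

/-- The weight of a cut: the number of edges crossing it. -/
noncomputable def cutWeight (G : Graph α β) (S : Set α) : ℕ :=
  (cutEdges G S).ncard

/-- The weight of a minimum cut. The set is nonempty, and so the infimum is attained, as soon
as `G` has at least two vertices. -/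
noncomputable def minCutValue (G : Graph α β) : ℕ :=
  sInf {k | ∃ S, IsCut G S ∧ cutWeight G S = k}

/-- `S` is one side of a minimum cut. -/
def IsMinCut (G : Graph α β) (S : Set α) : Prop :=
  IsCut G S ∧ cutWeight G S = minCutValue G

end TreePacking

namespace TreePacking

variable {α β : Type*} {G : Graph α β} {A B : Set β} {T F : Finset β} {c : β → ℕ}
  {e f : β} {x y z u v : α} {P : Multiset (Finset β)} {S : Set α}

/-! Write `λ` for the minimum cut value, `m` for the number of edges, `k` for the number of trees
and `δ = ε / 2`. Claim 1 follows from the potential `Φ = ∑ (1 + δ) ^ load`, summed over all edges.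
Removing from a minimum spanning tree its `r > 0` edges of cost at least `t` leaves more than `r`
components. Only edges of cost at least `t` run between them, and each component has at least `λ`
boundary edges, so there are at least `r * λ / 2` such edges (`card_filter_mul_minCutValue_le`).
Summing over `t` shows that each greedy step multiplies `Φ` by at most `1 + 2 * δ / λ`
(`sum_pow_load_take_le`). Hence `(1 + δ) ^ load e ≤ m * exp (2 * δ * k / λ)`, and logarithms bound
every load by `(2 + ε) * k / λ` (`load_le`). Claim 2 is double counting of loads on the cut
(`IsTreePacking.packVal_le`); greediness plays no role there. -/

/-! ### Walks inside an edge set -/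

theorem Joined.refl (G : Graph α β) (A : Set β) (x : α) : Joined G A x x :=
  Relation.ReflTransGen.refl

theorem Joined.trans (h : Joined G A x y) (h' : Joined G A y z) : Joined G A x z :=
  Relation.ReflTransGen.trans h h'

theorem Joined.of_isLink (h : G.IsLink e x y) (he : e ∈ A) : Joined G A x y :=
  Relation.ReflTransGen.single ⟨e, by simpa using ⟨he, h⟩⟩

theorem Joined.induction {p : α → Prop} (h : Joined G A x y) (base : p x)
    (step : ∀ u v e, Joined G A x u → e ∈ A → G.IsLink e u v → p u → p v) : p y := by
  induction h with
  | refl => exact base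
  | tail hu hv ih =>
    obtain ⟨e, he⟩ := hv
    simp only [Graph.restrict_isLink] at he
    exact step _ _ e hu he.1 he.2 ih

theorem Joined.symm (h : Joined G A x y) : Joined G A y x :=
  h.induction (p := fun z => Joined G A z x) (Joined.refl _ _ _) fun _ _ _ _ he hl ih => (Joined.of_isLink hl.symm he).trans ih

theorem Joined.mono (hAB : A ⊆ B) (h : Joined G A x y) : Joined G B x y :=
  h.induction (Joined.refl _ _ _) fun _ _ _ _ he hl ih => ih.trans (.of_isLink hl (hAB he))

theorem Joined.mono_of_forall
    (hAB : ∀ e ∈ A, ∀ u v, G.IsLink e u v → Joined G B u v) (h : Joined G A x y) :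
    Joined G B x y :=
  h.induction (Joined.refl _ _ _) fun _ _ _ _ he hl ih => ih.trans (hAB _ he _ _ hl)

theorem Joined.of_insert (hl : G.IsLink e x y) (h : Joined G (insert e B) u v) :
    Joined G B u v ∨ (Joined G B u x ∧ Joined G B y v) ∨ (Joined G B u y ∧ Joined G B x v) := by
  refine h.induction (p := fun v => Joined G B u v ∨ (Joined G B u x ∧ Joined G B y v) ∨
    (Joined G B u y ∧ Joined G B x v)) (Or.inl (Joined.refl _ _ _)) ?_
  intro a b g _ hg hlg ih
  by_cases hgB : g ∈ B
  · have hab := Joined.of_isLink hlg hgB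
    rcases ih with ih | ih | ih
    · exact Or.inl (ih.trans hab)
    · exact Or.inr (Or.inl ⟨ih.1, ih.2.trans hab⟩)
    · exact Or.inr (Or.inr ⟨ih.1, ih.2.trans hab⟩)
  · obtain rfl : g = e := by simpa [hgB] using hg
    rcases hl.eq_and_eq_or_eq_and_eq hlg with ⟨rfl, rfl⟩ | ⟨rfl, rfl⟩
    · rcases ih with ih | ih | ih
      · exact Or.inr (Or.inl ⟨ih, .refl _ _ _⟩)
      · exact Or.inr (Or.inl ⟨ih.1, .refl _ _ _⟩)
      · exact Or.inl ih.1
    · rcases ih with ih | ih | ih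
      · exact Or.inr (Or.inr ⟨ih, .refl _ _ _⟩)
      · exact Or.inl ih.1
      · exact Or.inr (Or.inr ⟨ih.1, .refl _ _ _⟩)

/-! ### Edge exchange in spanning trees -/

/-- Exchange: if removing the edges of `F` from `T` separates `x` from `y`, then so does the
removal of a single edge of `F`, and adding `e` joins the ends of that edge again. -/
theorem IsSpanningTree.exists_separating_edge (hT : IsSpanningTree G T)
    (hxy : Joined G (T : Set β) x y) (hF : F ⊆ T)
    (hn : ¬ Joined G ((T : Set β) \ F) x y) :
    ∃ f ∈ F, ¬ Joined G ((T : Set β) \ {f}) x y := by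
  classical
  induction F using Finset.induction_on with
  | empty => simp [hxy] at hn
  | insert f F hfF ih =>
    -- If `f` is the deletion that first separates `x` from `y`, a walk avoiding `f` would close a
    -- cycle through `f`.
    by_cases hj : Joined G ((T : Set β) \ F) x y
    · refine ⟨f, Finset.mem_insert_self _ _, fun hxf => ?_⟩
      have hfT : f ∈ T := hF (Finset.mem_insert_self _ _)
      obtain ⟨a, b, hab⟩ := G.exists_isLink_of_mem_edgeSet (hT.subset hfT)
      have hsub : (T : Set β) \ F ⊆ insert f ((T : Set β) \ (insert f F : Finset β)) := by
        intro g hg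
        by_cases h : g = f
        · exact Or.inl h
        · exact Or.inr ⟨hg.1, by simpa [h] using hg.2⟩
      have hsub' : (T : Set β) \ (insert f F : Finset β) ⊆ (T : Set β) \ {f} := by
        intro g hg
        exact ⟨hg.1, fun h => hg.2 (by simp [Set.mem_singleton_iff.1 h])⟩
      rcases (hj.mono hsub).of_insert hab with h | h | h
      · exact hn h
      · exact hT.acyclic f hfT a b hab
          (((h.1.mono hsub').symm.trans hxf).trans (h.2.mono hsub').symm)
      · exact hT.acyclic f hfT a b hab
          ((h.2.mono hsub').trans (hxf.symm.trans (h.1.mono hsub')))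
    · obtain ⟨g, hg, hgn⟩ := ih ((Finset.subset_insert _ _).trans hF) hj
      exact ⟨g, Finset.mem_insert_of_mem hg, hgn⟩

open Classical in
theorem IsSpanningTree.exchange (hT : IsSpanningTree G T) (hl : G.IsLink e x y) (hf : f ∈ T)
    (hn : ¬ Joined G ((T : Set β) \ {f}) x y) :
    IsSpanningTree G (insert e (T.erase f)) := by
  obtain ⟨a, b, hab⟩ := G.exists_isLink_of_mem_edgeSet (hT.subset hf)
  have hcoe : ((insert e (T.erase f) : Finset β) : Set β) = insert e ((T : Set β) \ {f}) := by
    simp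
  have hins : insert f ((T : Set β) \ {f}) = (T : Set β) := by
    simpa using hf
  have hsub : (T : Set β) \ {f} ⊆ insert e ((T : Set β) \ {f}) := Set.subset_insert _ _
  refine ⟨?_, ?_, ?_⟩
  · rw [hcoe]
    exact Set.insert_subset hl.edge_mem (Set.sdiff_subset.trans hT.subset)
  · intro u hu v hv
    rw [hcoe]
    refine (hT.connected u hu v hv).mono_of_forall ?_
    intro g hg p q hpq
    by_cases hgf : g = f
    · subst hgf
      have hxye : Joined G (insert e ((T : Set β) \ {g})) x y := .of_isLink hl (Or.inl rfl)
      have hj : Joined G (insert g ((T : Set β) \ {g})) x y := by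
        rw [hins]; exact hT.connected x hl.left_mem y hl.right_mem
      rcases hj.of_insert hpq with h | h | h
      · exact absurd h hn
      · exact ((h.1.mono hsub).symm.trans hxye).trans (h.2.mono hsub).symm
      · exact (h.2.mono hsub).trans (hxye.symm.trans (h.1.mono hsub))
    · exact .of_isLink hpq (Or.inr ⟨hg, hgf⟩)
  · intro g hg p q hpq hj
    rw [hcoe] at hj
    by_cases hge : g = e
    · subst hge
      have hj' : Joined G ((T : Set β) \ {f}) p q := by
        refine hj.mono ?_
        rintro h ⟨h1 | h1, h2⟩
        · exact absurd h1 h2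
        · exact h1
      rcases hl.eq_and_eq_or_eq_and_eq hpq with ⟨rfl, rfl⟩ | ⟨rfl, rfl⟩
      · exact hn hj'
      · exact hn hj'.symm
    · have hgT : g ∈ (T : Set β) \ {f} := by
        rw [← Finset.mem_coe, hcoe] at hg
        exact hg.resolve_left hge
      have hj' : Joined G (insert e (((T : Set β) \ {f}) \ {g})) p q := by
        refine hj.mono ?_
        rintro h ⟨h1 | h1, h2⟩
        · exact Or.inl h1
        · exact Or.inr ⟨h1, h2⟩
      have hs : ((T : Set β) \ {f}) \ {g} ⊆ (T : Set β) \ {f} := Set.sdiff_subset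
      have hpq' : Joined G ((T : Set β) \ {f}) p q := .of_isLink hpq hgT
      rcases hj'.of_insert hl with h | h | h
      · refine hT.acyclic g hgT.1 p q hpq (h.mono ?_)
        exact Set.sdiff_subset_sdiff_left Set.sdiff_subset
      · exact hn (((h.1.mono hs).symm.trans hpq').trans (h.2.mono hs).symm)
      · exact hn ((h.2.mono hs).trans (hpq'.symm.trans (h.1.mono hs)))

/-- The ends of an edge of cost less than `t` are joined by tree edges of cost less than `t`. -/
theorem IsMinSpanningTree.joined_of_cost_lt (hT : IsMinSpanningTree G c T)
    (hl : G.IsLink e x y) {t : ℕ} (ht : c e < t) :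
    Joined G ((T : Set β) \ (T.filter (t ≤ c ·) : Finset β)) x y := by
  classical
  by_contra hn
  obtain ⟨f, hf, hfn⟩ := hT.1.exists_separating_edge
    (hT.1.connected x hl.left_mem y hl.right_mem) (Finset.filter_subset _ _) hn
  obtain ⟨hfT, hft⟩ := Finset.mem_filter.1 hf
  -- Swapping `f` for `e` cannot lower the cost, yet `c e < t ≤ c f`.
  have hle := hT.2 _ (hT.1.exchange hl hfT hfn)
  have heT : e ∉ T.erase f := fun he =>
    hfn (.of_isLink hl ⟨Finset.mem_of_mem_erase he, Finset.ne_of_mem_erase he⟩)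
  rw [Finset.sum_insert heT, ← Finset.add_sum_erase _ _ hfT] at hle
  omega

/-! ### Components and cuts -/

/-- The partition of the vertices into the components of `(V(G), A)`. -/
def componentSetoid (G : Graph α β) (A : Set β) : Setoid G.vertexSet where
  r x y := Joined G A x y
  iseqv := ⟨fun _ => .refl _ _ _, Joined.symm, Joined.trans⟩

/-- By acyclicity, each further deletion separates the ends of the deleted edge, so the map to the
coarser partition is surjective but not injective. -/
theorem IsSpanningTree.card_lt_card_components (hT : IsSpanningTree G T)
    (hV : G.vertexSet.Finite) (hV0 : G.vertexSet.Nonempty) (hF : F ⊆ T) :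
    F.card < Nat.card (Quotient (componentSetoid G ((T : Set β) \ F))) := by
  classical
  have := hV.to_subtype
  induction F using Finset.induction_on with
  | empty =>
    obtain ⟨x, hx⟩ := hV0
    have : Nonempty (Quotient (componentSetoid G ((T : Set β) \ (∅ : Finset β)))) :=
      ⟨Quotient.mk _ ⟨x, hx⟩⟩
    exact Nat.card_pos
  | insert f F hfF ih =>
    have ih := ih ((Finset.subset_insert _ _).trans hF)
    rw [Finset.card_insert_of_notMem hfF]
    have hfT : f ∈ T := hF (Finset.mem_insert_self _ _)
    obtain ⟨a, b, hab⟩ := G.exists_isLink_of_mem_edgeSet (hT.subset hfT)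
    have hsub : (T : Set β) \ (insert f F : Finset β) ⊆ (T : Set β) \ F :=
      Set.sdiff_subset_sdiff_right (by simp)
    let φ : Quotient (componentSetoid G ((T : Set β) \ (insert f F : Finset β))) →
        Quotient (componentSetoid G ((T : Set β) \ F)) :=
      Quotient.map id fun _ _ h => Joined.mono hsub h
    have hφ : Function.Surjective φ := by
      rintro ⟨x⟩
      exact ⟨Quotient.mk _ x, rfl⟩
    have hφ' : ¬ Function.Injective φ := by
      intro hinj
      have h : φ (Quotient.mk _ ⟨a, hab.left_mem⟩) = φ (Quotient.mk _ ⟨b, hab.right_mem⟩) :=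
        Quotient.sound (Joined.of_isLink hab ⟨hfT, by simpa using hfF⟩)
      have h' : Joined G ((T : Set β) \ (insert f F : Finset β)) a b := Quotient.exact (hinj h)
      exact hT.acyclic f hfT a b hab (h'.mono (Set.sdiff_subset_sdiff_right (by simp)))
    have hle := Nat.card_le_card_of_surjective φ hφ
    have hne : Nat.card (Quotient (componentSetoid G ((T : Set β) \ F))) ≠
        Nat.card (Quotient (componentSetoid G ((T : Set β) \ (insert f F : Finset β)))) := by
      intro h
      exact hφ' ((Nat.bijective_iff_surjective_and_card φ).2 ⟨hφ, h.symm⟩).1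
    omega

theorem minCutValue_le (hS : IsCut G S) : minCutValue G ≤ cutWeight G S :=
  Nat.sInf_le ⟨S, hS, rfl⟩

theorem cutEdges_subset : cutEdges G S ⊆ G.edgeSet := by
  rintro e ⟨x, -, y, -, h⟩
  exact h.edge_mem

/-- Every component of `(V(G), A)` is a cut, and each edge crosses at most two of these cuts. -/
theorem card_components_mul_minCutValue_le (hV : G.vertexSet.Finite)
    (h2 : 1 < Nat.card (Quotient (componentSetoid G A)))
    (hF : ∀ e x y, G.IsLink e x y → ¬ Joined G A x y → e ∈ F) (hFE : (F : Set β) ⊆ G.edgeSet) :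
    Nat.card (Quotient (componentSetoid G A)) * minCutValue G ≤ 2 * F.card := by
  classical
  have := hV.to_subtype
  let Q := Quotient (componentSetoid G A)
  have : Fintype Q := Fintype.ofFinite Q
  let side : Q → Set α := fun q => {x | ∃ h : x ∈ G.vertexSet, (Quotient.mk _ ⟨x, h⟩ : Q) = q}
  have hside : ∀ q, IsCut G (side q) := by
    intro q
    refine ⟨?_, ?_⟩
    · obtain ⟨x, rfl⟩ := Quotient.exists_rep q
      exact ⟨x, x.2, rfl⟩
    · refine ⟨fun x hx => hx.1, fun hsub => ?_⟩
      have : Nontrivial Q := Finite.one_lt_card_iff_nontrivial.1 h2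
      obtain ⟨q', hq'⟩ := exists_ne q
      obtain ⟨x, rfl⟩ := Quotient.exists_rep q'
      exact hq' (hsub x.2).2
  have hcut : ∀ q, cutEdges G (side q) ⊆ F := by
    rintro q e ⟨x, ⟨hx, hxq⟩, y, ⟨hy, hyq⟩, hl⟩
    refine hF e x y hl fun hj => hyq ⟨hy, ?_⟩
    rw [← hxq]
    exact Quotient.sound hj.symm
  have hlow : ∀ q, minCutValue G ≤ (F.filter fun e => e ∈ cutEdges G (side q)).card := by
    intro q
    refine (minCutValue_le (hside q)).trans_eq ?_
    rw [cutWeight, ← Set.ncard_coe_finset]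
    congr 1
    ext e
    simpa using fun h => hcut q h
  -- An edge can only leave the components of its two ends.
  have hup : ∀ e ∈ F, (Finset.univ.filter fun q : Q => e ∈ cutEdges G (side q)).card ≤ 2 := by
    intro e he
    obtain ⟨a, b, hab⟩ := G.exists_isLink_of_mem_edgeSet (hFE he)
    have : (Finset.univ.filter fun q : Q => e ∈ cutEdges G (side q)) ⊆
        {(Quotient.mk _ ⟨a, hab.left_mem⟩ : Q), (Quotient.mk _ ⟨b, hab.right_mem⟩ : Q)} := by
      intro q hq
      obtain ⟨x, ⟨hx, hxq⟩, y, -, hl⟩ := (Finset.mem_filter.1 hq).2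
      rcases hl.left_eq_or_eq hab with rfl | rfl
      · simp [← hxq]
      · simp [← hxq]
    exact (Finset.card_le_card this).trans Finset.card_le_two
  calc Nat.card Q * minCutValue G = ∑ _q : Q, minCutValue G := by simp [Nat.card_eq_fintype_card]
    _ ≤ ∑ q : Q, (F.filter fun e => e ∈ cutEdges G (side q)).card :=
        Finset.sum_le_sum fun q _ => hlow q
    _ = ∑ e ∈ F, (Finset.univ.filter fun q : Q => e ∈ cutEdges G (side q)).card :=
        Finset.sum_card_bipartiteAbove_eq_sum_card_bipartiteBelow
          (fun (q : Q) e => e ∈ cutEdges G (side q))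
    _ ≤ ∑ _e ∈ F, 2 := Finset.sum_le_sum hup
    _ = 2 * F.card := by simp [mul_comm]

theorem IsMinSpanningTree.card_filter_mul_minCutValue_le (hT : IsMinSpanningTree G c T)
    (hV : G.vertexSet.Finite) (hV0 : G.vertexSet.Nonempty) (hE : G.edgeSet.Finite) (t : ℕ) :
    (T.filter (t ≤ c ·)).card * minCutValue G ≤ 2 * (hE.toFinset.filter (t ≤ c ·)).card := by
  classical
  -- A positive count guarantees two components, so that each one is a proper cut.
  rcases Nat.eq_zero_or_pos (T.filter (t ≤ c ·)).card with h0 | h0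
  · simp [h0]
  have hlt := hT.1.card_lt_card_components hV hV0 (Finset.filter_subset (t ≤ c ·) T)
  refine (Nat.mul_le_mul_right _ hlt.le).trans
    (card_components_mul_minCutValue_le hV (by omega) ?_ ?_)
  · intro e x y hl hn
    simp only [Finset.mem_filter, Set.Finite.mem_toFinset]
    refine ⟨hl.edge_mem, ?_⟩
    by_contra h
    exact hn (hT.joined_of_cost_lt hl (not_le.1 h))
  · intro e he
    simpa using (Finset.mem_filter.1 he).1

/-! ### The exponential potential -/

theorem pow_eq_sum_indicator (δ : ℝ) {n N : ℕ} (h : n ≤ N) :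
    (1 + δ) ^ n = 1 + ∑ j ∈ Finset.range N, δ * (1 + δ) ^ j * (if j + 1 ≤ n then 1 else 0) := by
  have h1 : ∑ j ∈ Finset.range N, δ * (1 + δ) ^ j * (if j + 1 ≤ n then 1 else 0) =
      ∑ j ∈ Finset.range n, δ * (1 + δ) ^ j := by
    simp only [mul_ite, mul_one, mul_zero]
    rw [← Finset.sum_filter]
    refine Finset.sum_congr ?_ fun _ _ => rfl
    ext j
    simp only [Finset.mem_filter, Finset.mem_range]
    omega
  rw [h1, ← Finset.mul_sum, mul_comm, ← sub_eq_iff_eq_add', ← geom_sum_mul]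
  ring

/-- Layer-cake formula: it turns bounds on the number of edges above each threshold into bounds on
exponential sums. -/
theorem sum_pow_eq (δ : ℝ) (s : Finset β) {N : ℕ} (hN : ∀ e ∈ s, c e ≤ N) :
    ∑ e ∈ s, (1 + δ) ^ c e = ((s.filter (0 ≤ c ·)).card : ℝ) +
      ∑ j ∈ Finset.range N, δ * (1 + δ) ^ j * ((s.filter (j + 1 ≤ c ·)).card : ℝ) := by
  rw [Finset.sum_congr rfl fun e he => pow_eq_sum_indicator δ (hN e he), Finset.sum_add_distrib,
    Finset.sum_comm]
  simp only [← Finset.mul_sum, Finset.sum_boole]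
  simp

theorem IsMinSpanningTree.sum_pow_mul_minCutValue_le (hT : IsMinSpanningTree G c T)
    (hV : G.vertexSet.Finite) (hV0 : G.vertexSet.Nonempty) (hE : G.edgeSet.Finite)
    {δ : ℝ} (hδ : 0 ≤ δ) :
    (∑ e ∈ T, (1 + δ) ^ c e) * minCutValue G ≤ 2 * ∑ e ∈ hE.toFinset, (1 + δ) ^ c e := by
  have hN : ∀ e ∈ hE.toFinset, c e ≤ hE.toFinset.sup c := fun e he => Finset.le_sup he
  have hTE : T ⊆ hE.toFinset := fun e he => by simpa using hT.1.subset he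
  have key : ∀ t, ((T.filter (t ≤ c ·)).card : ℝ) * minCutValue G ≤
      2 * (hE.toFinset.filter (t ≤ c ·)).card := fun t => by
    exact_mod_cast hT.card_filter_mul_minCutValue_le hV hV0 hE t
  rw [sum_pow_eq δ T fun e he => hN e (hTE he), sum_pow_eq δ _ hN, add_mul, mul_add,
    Finset.sum_mul, Finset.mul_sum]
  refine add_le_add (key 0) (Finset.sum_le_sum fun j _ => ?_)
  have h0 : 0 ≤ δ * (1 + δ) ^ j := by positivity
  nlinarith [mul_le_mul_of_nonneg_left (key (j + 1)) h0]

open Classical in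
theorem load_append_singleton (L : List (Finset β)) (T : Finset β) (e : β) :
    load ((L ++ [T] : List (Finset β)) : Multiset (Finset β)) e =
      load (L : Multiset (Finset β)) e + if e ∈ T then 1 else 0 := by
  simp [load, List.countP_append, List.countP_cons]

theorem sum_pow_load_take_le (hV : G.vertexSet.Finite) (hV0 : G.vertexSet.Nonempty)
    (hE : G.edgeSet.Finite) {δ : ℝ} (hδ : 0 ≤ δ) (hl : 0 < minCutValue G)
    {L : List (Finset β)} (hL : ∀ (i : ℕ) (hi : i < L.length),
      IsMinSpanningTree G (load (L.take i : Multiset (Finset β))) L[i]) (i : ℕ)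
    (hi : i ≤ L.length) :
    ∑ e ∈ hE.toFinset, (1 + δ) ^ load (L.take i : Multiset (Finset β)) e ≤
      hE.toFinset.card * (1 + 2 * δ / minCutValue G) ^ i := by
  classical
  induction i with
  | zero => simp [load]
  | succ i ih =>
    have hl' : (0 : ℝ) < minCutValue G := by exact_mod_cast hl
    have hT := hL i hi
    have hTE : L[i] ⊆ hE.toFinset := fun e he => by simpa using hT.1.subset he
    have hstep := hT.sum_pow_mul_minCutValue_le hV hV0 hE hδ
    rw [← le_div_iff₀ hl'] at hstep
    -- Adding `L[i]` multiplies exactly the terms of its own edges by `1 + δ`.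
    have heq : ∑ e ∈ hE.toFinset, (1 + δ) ^ load (L.take (i + 1) : Multiset (Finset β)) e =
        ∑ e ∈ hE.toFinset, (1 + δ) ^ load (L.take i : Multiset (Finset β)) e +
          δ * ∑ e ∈ L[i], (1 + δ) ^ load (L.take i : Multiset (Finset β)) e := by
      rw [← Finset.inter_eq_right.2 hTE, ← Finset.filter_mem_eq_inter, Finset.sum_filter,
        Finset.mul_sum, ← Finset.sum_add_distrib]
      refine Finset.sum_congr rfl fun e _ => ?_
      rw [List.take_succ_eq_append_getElem hi, load_append_singleton]
      split_ifs <;> simp [pow_succ]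
      ring
    rw [heq]
    calc _ ≤ ∑ e ∈ hE.toFinset, (1 + δ) ^ load (L.take i : Multiset (Finset β)) e + δ *
          (2 * ∑ e ∈ hE.toFinset, (1 + δ) ^ load (L.take i : Multiset (Finset β)) e /
            minCutValue G) := by
            rw [← Finset.sum_div, ← mul_div_assoc]; gcongr
      _ = (∑ e ∈ hE.toFinset, (1 + δ) ^ load (L.take i : Multiset (Finset β)) e) *
          (1 + 2 * δ / minCutValue G) := by rw [← Finset.sum_div]; ring
      _ ≤ (hE.toFinset.card * (1 + 2 * δ / minCutValue G) ^ i) *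
          (1 + 2 * δ / minCutValue G) := by
            gcongr
            exact ih (by omega)
      _ = _ := by rw [pow_succ]; ring

/-- From `log (1 + δ) ≥ 2 * δ / (δ + 2)`; what remains is `δ ^ 2 * (1 - δ) ≥ 0`, hence the
restriction `ε ≤ 2` later. -/
theorem add_sq_div_three_le_mul_log {δ : ℝ} (h0 : 0 ≤ δ) (h1 : δ ≤ 1) :
    δ + δ ^ 2 / 3 ≤ (1 + δ) * Real.log (1 + δ) := by
  refine le_trans ?_ (mul_le_mul_of_nonneg_left (Real.le_log_one_add_of_nonneg h0)
    (by linarith))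
  rw [← mul_div_assoc, le_div_iff₀ (by linarith)]
  nlinarith [mul_nonneg (sq_nonneg δ) (sub_nonneg.2 h1)]

theorem IsGreedyTreePacking.load_le (hP : IsGreedyTreePacking G P)
    (hV : G.vertexSet.Finite) (hV0 : G.vertexSet.Nonempty) (hE : G.edgeSet.Finite)
    (hl : 0 < minCutValue G) {ε : ℝ} (hε : 0 < ε) (hε2 : ε ≤ 2)
    (hcard : 6 * (minCutValue G : ℝ) * Real.log (G.edgeSet.ncard : ℝ) / ε ^ 2
      ≤ (Multiset.card P : ℝ)) (he : e ∈ G.edgeSet) :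
    (load P e : ℝ) ≤ (2 + ε) / minCutValue G * Multiset.card P := by
  obtain ⟨-, L, rfl, hL⟩ := hP
  have hl' : (0 : ℝ) < minCutValue G := by exact_mod_cast hl
  have hm : (0 : ℝ) < G.edgeSet.ncard := by
    exact_mod_cast (Set.ncard_pos hE).2 ⟨e, he⟩
  set l : ℝ := (minCutValue G : ℝ)
  set n : ℕ := load (L : Multiset (Finset β)) e
  have hΦ := sum_pow_load_take_le hV hV0 hE (half_pos hε).le hl hL L.length le_rfl
  rw [List.take_length, ← Set.ncard_eq_toFinset_card _ hE] at hΦ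
  have h1 : (1 + ε / 2) ^ n ≤ G.edgeSet.ncard * Real.exp (ε / l) ^ L.length := by
    refine (Finset.single_le_sum (f := fun e => (1 + ε / 2) ^ load (L : Multiset (Finset β)) e)
      (fun _ _ => by positivity) (hE.mem_toFinset.2 he)).trans (hΦ.trans ?_)
    gcongr
    have := Real.add_one_le_exp (ε / l)
    rw [show 2 * (ε / 2) = ε by ring]
    linarith
  have h2 := Real.log_le_log (by positivity) h1
  rw [Real.log_pow, Real.log_mul hm.ne' (by positivity), Real.log_pow, Real.log_exp] at h2
  -- The constant 6 makes this term equal `(2 * k / λ) * (δ ^ 2 / 3)`, the second-order slack in the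
  -- logarithm bound.
  have h3 : Real.log G.edgeSet.ncard ≤ ε ^ 2 * L.length / (6 * l) := by
    rw [div_le_iff₀ (by positivity), Multiset.coe_card] at hcard
    rw [le_div_iff₀ (by positivity)]
    linarith
  have h4 := add_sq_div_three_le_mul_log (half_pos hε).le (by linarith : ε / 2 ≤ 1)
  have hlog : 0 < Real.log (1 + ε / 2) := Real.log_pos (by linarith)
  refine le_of_mul_le_mul_right ?_ hlog
  calc (n : ℝ) * Real.log (1 + ε / 2) ≤ ε ^ 2 * L.length / (6 * l) + L.length * (ε / l) := by
        linarith
    _ = 2 * L.length / l * (ε / 2 + (ε / 2) ^ 2 / 3) := by field_simp; ring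
    _ ≤ 2 * L.length / l * ((1 + ε / 2) * Real.log (1 + ε / 2)) := by gcongr
    _ = _ := by rw [Multiset.coe_card]; field_simp

/-! ### From loads to the packing value -/

theorem relLoad_le_iSup (hE : G.edgeSet.Finite) (he : e ∈ G.edgeSet) :
    relLoad P e ≤ ⨆ e : G.edgeSet, relLoad P (e : β) := by
  have := hE.to_subtype
  exact le_ciSup (f := fun e : G.edgeSet => relLoad P (e : β)) (Set.finite_range _).bddAbove
    ⟨e, he⟩

theorem relLoad_nonneg (P : Multiset (Finset β)) (e : β) : 0 ≤ relLoad P e := by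
  unfold relLoad; positivity

theorem packVal_nonneg (G : Graph α β) (P : Multiset (Finset β)) : 0 ≤ packVal G P :=
  one_div_nonneg.2 (Real.iSup_nonneg fun _ => relLoad_nonneg P _)

theorem IsSpanningTree.nonempty (hT : IsSpanningTree G T) (hV2 : G.vertexSet.Nontrivial) :
    T.Nonempty := by
  obtain ⟨x, hx, y, hy, hxy⟩ := hV2
  by_contra h
  rw [Finset.not_nonempty_iff_eq_empty] at h
  refine hxy ((hT.connected x hx y hy).induction (p := fun z => x = z) rfl ?_)
  intro u v e _ he
  simp [h] at he

theorem IsTreePacking.iSup_relLoad_pos (hP : IsTreePacking G P) (hP0 : P ≠ 0)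
    (hV2 : G.vertexSet.Nontrivial) (hE : G.edgeSet.Finite) :
    0 < ⨆ e : G.edgeSet, relLoad P (e : β) := by
  classical
  obtain ⟨T, hT⟩ := Multiset.exists_mem_of_ne_zero hP0
  obtain ⟨e, he⟩ := (hP T hT).nonempty hV2
  refine lt_of_lt_of_le ?_ (relLoad_le_iSup hE ((hP T hT).subset he))
  have h1 : 0 < load P e := Multiset.countP_pos.2 ⟨T, hT, he⟩
  have h2 : 0 < Multiset.card P := Multiset.card_pos.2 hP0
  unfold relLoad
  positivity

theorem IsGreedyTreePacking.minCutValue_le_mul_packVal (hP : IsGreedyTreePacking G P)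
    (hP0 : P ≠ 0) (hV : G.vertexSet.Finite) (hV2 : G.vertexSet.Nontrivial)
    (hE : G.edgeSet.Finite) {ε : ℝ} (hε : 0 < ε) (hε2 : ε ≤ 2)
    (hcard : 6 * (minCutValue G : ℝ) * Real.log (G.edgeSet.ncard : ℝ) / ε ^ 2
      ≤ (Multiset.card P : ℝ)) :
    (minCutValue G : ℝ) ≤ (2 + ε) * packVal G P := by
  rcases Nat.eq_zero_or_pos (minCutValue G) with h0 | h0
  · rw [h0, Nat.cast_zero]
    exact mul_nonneg (by linarith) (packVal_nonneg _ _)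
  have hk : (0 : ℝ) < Multiset.card P := by exact_mod_cast Multiset.card_pos.2 hP0
  have hl : (0 : ℝ) < minCutValue G := by exact_mod_cast h0
  have hM := hP.1.iSup_relLoad_pos hP0 hV2 hE
  have hle : ⨆ e : G.edgeSet, relLoad P (e : β) ≤ (2 + ε) / minCutValue G := by
    refine Real.iSup_le (fun e => ?_) (by positivity)
    rw [relLoad, div_le_iff₀ hk]
    exact hP.load_le hV hV2.nonempty hE h0 hε hε2 hcard e.2
  rw [packVal, mul_one_div, le_div_iff₀ hM]
  rwa [le_div_iff₀ hl, mul_comm] at hle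

theorem sum_load_eq (F : Finset β) [DecidableEq β] (P : Multiset (Finset β)) :
    ∑ e ∈ F, load P e = (P.map fun T => (F ∩ T).card).sum := by
  classical
  induction P using Multiset.induction_on with
  | empty => simp [load]
  | cons T P ih =>
    rw [Multiset.map_cons, Multiset.sum_cons, ← ih, add_comm, Finset.card_eq_sum_ones,
      ← Finset.filter_mem_eq_inter, Finset.sum_filter, ← Finset.sum_add_distrib]
    refine Finset.sum_congr rfl fun e _ => ?_
    simp only [load, Multiset.countP_cons]
    congr

theorem IsTreePacking.packVal_le (hP : IsTreePacking G P) (hP0 : P ≠ 0)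
    (hV2 : G.vertexSet.Nontrivial) (hE : G.edgeSet.Finite)
    (h2 : ∀ T ∈ P, 2 ≤ (cutEdges G S ∩ (T : Set β)).ncard) :
    2 * packVal G P ≤ cutWeight G S := by
  classical
  have hfin : (cutEdges G S).Finite := hE.subset cutEdges_subset
  have hk : (0 : ℝ) < Multiset.card P := by exact_mod_cast Multiset.card_pos.2 hP0
  have hM := hP.iSup_relLoad_pos hP0 hV2 hE
  -- The total load on the cut counts pairs of a tree and a cut edge in it: at least two per tree.
  have hsum : 2 * Multiset.card P ≤ ∑ e ∈ hfin.toFinset, load P e := by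
    rw [sum_load_eq, mul_comm, ← smul_eq_mul, ← Multiset.card_map]
    refine Multiset.card_nsmul_le_sum fun n hn => ?_
    obtain ⟨T, hT, rfl⟩ := Multiset.mem_map.1 hn
    refine (h2 T hT).trans_eq ?_
    rw [← Set.ncard_coe_finset]
    simp
  have hload : ∀ e ∈ hfin.toFinset, (load P e : ℝ) ≤
      (⨆ e : G.edgeSet, relLoad P (e : β)) * Multiset.card P := by
    intro e he
    rw [← div_le_iff₀ hk]
    exact relLoad_le_iSup hE (cutEdges_subset (hfin.mem_toFinset.1 he))
  have hsum' := Finset.sum_le_sum hload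
  rw [Finset.sum_const, nsmul_eq_mul, ← Set.ncard_eq_toFinset_card _ hfin] at hsum'
  have hsum'' : (2 * Multiset.card P : ℝ) ≤ ∑ e ∈ hfin.toFinset, (load P e : ℝ) := by
    exact_mod_cast hsum
  rw [packVal, mul_one_div, div_le_iff₀ hM, cutWeight]
  refine le_of_mul_le_mul_right ?_ hk
  linarith

end TreePacking

theorem mainTheorem5 {α β : Type*} (G : Graph α β)
    (hV : G.vertexSet.Finite) (hE : G.edgeSet.Finite) (hV2 : G.vertexSet.Nontrivial)
    (ε : ℝ) (hε : 0 < ε)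
    (P : Multiset (Finset β)) (hP0 : P ≠ 0) (hP : TreePacking.IsGreedyTreePacking G P)
    (hcard : 6 * (TreePacking.minCutValue G : ℝ) * Real.log (G.edgeSet.ncard : ℝ) / ε ^ 2
      ≤ (Multiset.card P : ℝ)) :
    (ε < 2 → (TreePacking.minCutValue G : ℝ) ≤ (2 + ε) * TreePacking.packVal G P) ∧
    ((∃ S : Set α, TreePacking.IsMinCut G S ∧
        ∀ T ∈ P, 2 ≤ (TreePacking.cutEdges G S ∩ (T : Set β)).ncard) →
      (2 + ε) * TreePacking.packVal G P ≤ (1 + ε / 2) * (TreePacking.minCutValue G : ℝ)) := by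
  refine ⟨fun hε2 => hP.minCutValue_le_mul_packVal hP0 hV hV2 hE hε hε2.le hcard, ?_⟩
  rintro ⟨S, hS, h2⟩
  have h := hP.1.packVal_le hP0 hV2 hE h2
  rw [hS.2] at h
  calc (2 + ε) * TreePacking.packVal G P = (1 + ε / 2) * (2 * TreePacking.packVal G P) := by ring
    _ ≤ _ := by gcongr
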